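/- **Setting.** Let $\Omega$ be a closed and bounded set in a real normed space with $0\in\Omega$, and let $\mathbb P_\Omega$ be a (Borel) probability measure on $\Omega$. Consider a discrete-time control loop consisting of an uncertain process with matrices $A^\delta,B^\delta,C^\delta,C_J^\delta,D_J^\delta$ depending measurably on $\delta\in\Omega$, an output feedback controller and an anomaly detector, $$\begin{aligned} x_p[k+1]&=A^\delta x_p[k]+B^\delta\tilde u[k],& y[k]&=C^\delta x_p[k],& y_p[k]&=C_J^\delta x_p[k]+D_J^\delta\tilde u[k],\\ z[k+1]&=A_cz[k]+B_c\tilde y[k],& u[k]&=C_cz[k]+D_c\tilde y[k],\\ s[k+1]&=A_es[k]+B_eu[k]+K_e\tilde y[k],& y_r[k]&=C_es[k]+D_eu[k]+E_e\tilde y[k], \end{aligned}$$ under a false data injection attack $\tilde u[k]=u[k]+B_a a[k]$, $\tilde y[k]=y[k]+D_a a[k]$ with attack signal $a[k]\in\mathbb R^{n_a}$. With $x=(x_p,z,s)$ write the closed loop as $$x[k+1]=A_{cl}^\delta x[k]+B_{cl}^\delta a[k],\qquad y_p[k]=C_p^\delta x[k]+D_p^\delta a[k],\qquad y_r[k]=C_r^\delta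 x[k]+D_r^\delta a[k],\qquad x[0]=0,$$ and assume that it is asymptotically stable for every $\delta\in\Omega$, i.e. all eigenvalues of $A_{cl}^\delta$ lie in the open unit disc. With $\|y\|_{\ell_2}^2=\sum_{k\ge0}y[k]^Ty[k]$, the worst-case stealthy impact (squared output-to-output gain) for the uncertainty $\delta$ is $$f(\delta)=\sup_a\big\{\|y_p\|_{\ell_2}^2\;:\;\|y_r\|_{\ell_2}^2\le1,\ x[k]\to0\big\}\in[0,\infty],$$ the supremum being over all signals $a:\mathbb Z_{\ge0}\to\mathbb R^{n_a}$. Let $\gamma^{\rm SDP}(\delta)\in[0,\infty]$ be the optimal value ($+\infty$ if infeasible) of the semidefinite program $$\inf\{\gamma\ge0\;:\;\exists\,P=P^T,\ M(\gamma,\delta,P)\preceq0\},$$ $$M(\gamma,\delta,P)=\begin{bmatrix}A_{cl}^TPA_{cl}-P&A_{cl}^TPB_{cl}\\B_{cl}^TPA_{cl}&B_{cl}^TPB_{cl}\end{bmatrix}+\begin{bmatrix}C_p^T\\D_p^T\end{bmatrix}\begin{bmatrix}C_p&D_p\end{bmatrix}-\gamma\begin{bmatrix}C_r^T\\D_r^T\end{bmatrix}\begin{bmatrix}C_r&D_r\end{bmatrix}$$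 (all matrices taken at $\delta$). For $b\in\mathbb R$ put $\mathrm{VaR}_b=\inf\{\gamma\in\mathbb R:\mathbb P_\Omega(f\le\gamma)\ge1-b\}$, with $\inf\emptyset=+\infty$ and $\inf\mathbb R=-\infty$. **Theorem 1.** Let $\epsilon_1,\beta_1,\beta\in(0,1)$, let $N_1\ge\frac1{2\epsilon_1^2}\log\frac2{\beta_1}$, and let $\delta_1,\dots,\delta_{N_1}$ be i.i.d. samples with law $\mathbb P_\Omega$. Then: 1. $f$ is measurable, and $f(\delta)=\gamma^{\rm SDP}(\delta)$ for every $\delta\in\Omega$. 2. For every $\gamma\in\mathbb R$, $$\mathbb P\Big\{\Big|\mathbb P_\Omega(f\le\gamma)-\frac1{N_1}\sum_{i=1}^{N_1}\mathbb I\big(f(\delta_i)\le\gamma\big)\Big|\ge\epsilon_1\Big\}\le\beta_1 .$$ 3. Let $\gamma_i=\gamma^{\rm SDP}(\delta_i)$ and $$\hat\gamma_{OA}=\min\Big\{\gamma\in\mathbb R:\frac1{N_1}\sum_{i=1}^{N_1}\mathbb I(\gamma_i\le\gamma)\ge1-\beta\Big\},$$ where the minimum exists whenever the set is non-empty, and $\hat\gamma_{OA}=+\infty$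 otherwise. Then $\hat\gamma_{OA}$ is the Value-at-Risk $\mathrm{VaR}_\beta$ with accuracy $\epsilon_1$ in the probability level and confidence $\beta_1$: one has $\mathrm{VaR}_{\beta+\epsilon_1}\le\mathrm{VaR}_\beta\le\mathrm{VaR}_{\beta-\epsilon_1}$, and $$\mathbb P\big\{\mathrm{VaR}_{\beta+\epsilon_1}\le\hat\gamma_{OA}\le\mathrm{VaR}_{\beta-\epsilon_1}\ \text{fails}\big\}\le\beta_1 .$$ -/

import Mathlib

open MeasureTheory ProbabilityTheory Filter Topology
open scoped ENNReal Matrix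

noncomputable section

/-! ### Discrete-time LTI systems driven by an attack signal -/

/-- The closed loop under attack, with the performance output `y_p` and the residual `y_r` as
outputs:
`x[k+1] = A x[k] + B a[k]`, `y_p[k] = Cp x[k] + Dp a[k]`, `y_r[k] = Cr x[k] + Dr a[k]`. -/
structure AttackedSystem (n m p r : Type*) where
  A : Matrix n n ℝ
  B : Matrix n m ℝ
  Cp : Matrix p n ℝ
  Dp : Matrix p m ℝ
  Cr : Matrix r n ℝ
  Dr : Matrix r m ℝ

/-- The energy `‖y‖²_{ℓ₂} = ∑_{k ≥ 0} y[k]ᵀ y[k]` of a signal, in `[0, ∞]`. -/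
def energy {p : Type*} [Fintype p] (y : ℕ → p → ℝ) : ℝ≥0∞ :=
  ∑' k, ENNReal.ofReal (y k ⬝ᵥ y k)

namespace AttackedSystem

variable {n m p r : Type*} [Fintype n] [Fintype m] [Fintype p] [Fintype r]

/-- The state trajectory from the equilibrium `x[0] = 0` under the attack `a`. -/
def state (S : AttackedSystem n m p r) (a : ℕ → m → ℝ) : ℕ → n → ℝ
  | 0 => 0
  | k + 1 => S.A *ᵥ S.state a k + S.B *ᵥ a k

/-- The performance output `y_p`. -/
def perf (S : AttackedSystem n m p r) (a : ℕ → m → ℝ) (k : ℕ) : p → ℝ :=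
  S.Cp *ᵥ S.state a k + S.Dp *ᵥ a k

/-- The residual (detection output) `y_r`. -/
def resid (S : AttackedSystem n m p r) (a : ℕ → m → ℝ) (k : ℕ) : r → ℝ :=
  S.Cr *ᵥ S.state a k + S.Dr *ᵥ a k

/-- The attack `a` is admissible: `‖y_r‖² ≤ 1` (stealthiness) and `x[∞] = 0`. -/
def Stealthy (S : AttackedSystem n m p r) (a : ℕ → m → ℝ) : Prop :=
  energy (S.resid a) ≤ 1 ∧ Tendsto (S.state a) atTop (𝓝 0)

open Classical in
/-- The impact `‖y_p‖² · 𝕀(‖y_r‖² ≤ 1, x[∞] = 0)` of the attack `a`. -/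
def impact (S : AttackedSystem n m p r) (a : ℕ → m → ℝ) : ℝ≥0∞ :=
  energy (S.perf a) * (if S.Stealthy a then 1 else 0)

/-- The (squared) output-to-output gain: the supremum of the impact over all attack signals.
The extended space `ℓ_{2e}` contains every signal, since it only asks for finite energy over
every finite horizon. -/
def oog (S : AttackedSystem n m p r) : ℝ≥0∞ :=
  ⨆ a : ℕ → m → ℝ, S.impact a

/-- The matrix `M(γ, P)` of the dissipation inequality. -/
def lmi (S : AttackedSystem n m p r) (γ : ℝ) (P : Matrix n n ℝ) : Matrix (n ⊕ m) (n ⊕ m) ℝ :=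
  Matrix.fromBlocks
      (S.Aᵀ * P * S.A - P) (S.Aᵀ * P * S.B)
      (S.Bᵀ * P * S.A)     (S.Bᵀ * P * S.B)
    + (Matrix.fromCols S.Cp S.Dp)ᵀ * Matrix.fromCols S.Cp S.Dp
    - γ • ((Matrix.fromCols S.Cr S.Dr)ᵀ * Matrix.fromCols S.Cr S.Dr)

/-- The pairs `(γ, P)` that are feasible for the SDP: `γ ≥ 0`, `P = Pᵀ`, `M(γ, P) ⪯ 0`. -/
def SDPFeasible (S : AttackedSystem n m p r) (γ : ℝ) (P : Matrix n n ℝ) : Prop :=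
  0 ≤ γ ∧ P.IsSymm ∧ (-(S.lmi γ P)).PosSemidef

/-- The optimal value of the SDP, `+∞` if it is infeasible. -/
def sdpValue (S : AttackedSystem n m p r) : EReal :=
  sInf ((fun γ : ℝ => (γ : EReal)) '' {γ : ℝ | ∃ P : Matrix n n ℝ, S.SDPFeasible γ P})

/-- (Asymptotic) stability: every eigenvalue of `A` lies in the open unit disc. -/
def IsStable [DecidableEq n] (S : AttackedSystem n m p r) : Prop :=
  ∀ z ∈ spectrum ℂ (S.A.map (algebraMap ℝ ℂ)), ‖z‖ < 1

end AttackedSystem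

/-! ### Uncertain process, controller and detector -/

/-- An uncertain process, an output feedback controller, an anomaly detector, and the channels
through which the adversary injects data:
* process `x_p⁺ = A x_p + B ũ`, `y = C x_p`, `y_p = CJ x_p + DJ ũ`, whose matrices depend on the
  uncertainty `δ : Ω` (the nominal matrices are the values at `δ = 0`, and
  `ΔA(δ) = A δ - A 0`, similarly for the others);
* controller `z⁺ = Ac z + Bc ỹ`, `u = Cc z + Dc ỹ`;
* detector `s⁺ = Ae s + Be u + Ke ỹ`, `y_r = Ce s + De u + Ee ỹ`;
* attack `ũ = u + Ba a`, `ỹ = y + Da a`. -/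
structure UncertainLoop (Ω : Type*) (nx nz ns nu nm np nr na : ℕ) where
  A : Ω → Matrix (Fin nx) (Fin nx) ℝ
  B : Ω → Matrix (Fin nx) (Fin nu) ℝ
  C : Ω → Matrix (Fin nm) (Fin nx) ℝ
  CJ : Ω → Matrix (Fin np) (Fin nx) ℝ
  DJ : Ω → Matrix (Fin np) (Fin nu) ℝ
  Ac : Matrix (Fin nz) (Fin nz) ℝ
  Bc : Matrix (Fin nz) (Fin nm) ℝ
  Cc : Matrix (Fin nu) (Fin nz) ℝ
  Dc : Matrix (Fin nu) (Fin nm) ℝ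
  Ae : Matrix (Fin ns) (Fin ns) ℝ
  Be : Matrix (Fin ns) (Fin nu) ℝ
  Ke : Matrix (Fin ns) (Fin nm) ℝ
  Ce : Matrix (Fin nr) (Fin ns) ℝ
  De : Matrix (Fin nr) (Fin nu) ℝ
  Ee : Matrix (Fin nr) (Fin nm) ℝ
  Ba : Matrix (Fin nu) (Fin na) ℝ
  Da : Matrix (Fin nm) (Fin na) ℝ

namespace UncertainLoop

variable {Ω : Type*} {nx nz ns nu nm np nr na : ℕ}

/-- The closed loop for the uncertainty `δ`, with state `x = (x_p, z, s)`. -/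
def closedLoop (L : UncertainLoop Ω nx nz ns nu nm np nr na) (δ : Ω) :
    AttackedSystem (Fin nx ⊕ (Fin nz ⊕ Fin ns)) (Fin na) (Fin np) (Fin nr) where
  A := Matrix.fromBlocks
    (L.A δ + L.B δ * L.Dc * L.C δ)
    (Matrix.fromCols (L.B δ * L.Cc) 0)
    (Matrix.fromRows (L.Bc * L.C δ) ((L.Be * L.Dc + L.Ke) * L.C δ))
    (Matrix.fromBlocks L.Ac 0 (L.Be * L.Cc) L.Ae)
  B := Matrix.fromRows (L.B δ * L.Ba + L.B δ * L.Dc * L.Da)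
    (Matrix.fromRows (L.Bc * L.Da) ((L.Be * L.Dc + L.Ke) * L.Da))
  Cp := Matrix.fromCols (L.CJ δ + L.DJ δ * L.Dc * L.C δ)
    (Matrix.fromCols (L.DJ δ * L.Cc) 0)
  Dp := L.DJ δ * (L.Dc * L.Da + L.Ba)
  Cr := Matrix.fromCols ((L.De * L.Dc + L.Ee) * L.C δ)
    (Matrix.fromCols (L.De * L.Cc) L.Ce)
  Dr := (L.De * L.Dc + L.Ee) * L.Da

/-- The process matrices are measurable functions of the uncertainty. -/
def IsMeasurable [MeasurableSpace Ω] (L : UncertainLoop Ω nx nz ns nu nm np nr na) : Prop :=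
  (∀ i j, Measurable fun δ => L.A δ i j) ∧ (∀ i j, Measurable fun δ => L.B δ i j) ∧
  (∀ i j, Measurable fun δ => L.C δ i j) ∧ (∀ i j, Measurable fun δ => L.CJ δ i j) ∧
  (∀ i j, Measurable fun δ => L.DJ δ i j)

/-- The worst-case impact as a (possibly infinite) function of the uncertainty `δ`. -/
def worstImpact (L : UncertainLoop Ω nx nz ns nu nm np nr na) (δ : Ω) : EReal :=
  ((L.closedLoop δ).oog : EReal)

end UncertainLoop

/-! ### Value-at-Risk and its empirical counterpart -/

/-- `VaR_β(X) = inf {x ∈ ℝ | ℙ[X ≤ x] ≥ 1 - β}` as an extended real number. -/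
def valueAtRisk {Ω : Type*} [MeasurableSpace Ω] (μ : Measure Ω) (X : Ω → EReal) (β : ℝ) : EReal :=
  sInf ((fun x : ℝ => (x : EReal)) '' {x : ℝ | 1 - β ≤ μ.real {ω | X ω ≤ (x : EReal)}})

/-- The empirical probability `(1/N) ∑ᵢ 𝕀(gᵢ ≤ γ)`. -/
def empiricalProb {N : ℕ} (g : Fin N → EReal) (γ : ℝ) : ℝ :=
  (1 / (N : ℝ)) * ∑ i, Set.indicator (Set.Iic (γ : EReal)) (fun _ => (1 : ℝ)) (g i)

/-- The feasible set `{γ ∈ ℝ | (1/N) ∑ᵢ 𝕀(gᵢ ≤ γ) ≥ 1 - β}` of the sampled problem. -/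
def sampledFeasible {N : ℕ} (g : Fin N → EReal) (β : ℝ) : Set ℝ :=
  {γ : ℝ | 1 - β ≤ empiricalProb g γ}

/-- The optimal value of the sampled problem, `+∞` if it is infeasible. -/
def sampledVaR {N : ℕ} (g : Fin N → EReal) (β : ℝ) : EReal :=
  sInf ((fun γ : ℝ => (γ : EReal)) '' sampledFeasible g β)

end

/-! Deterministic part. The matrix inequality says that `x ↦ xᵀ P x` is a storage function for the
supply rate `γ ‖y_r‖² - ‖y_p‖²`. Summed along a trajectory from `0` back to `0` it telescopes to
`‖y_p‖² ≤ γ ‖y_r‖²`; this is weak duality, `oog_le_of_sdpFeasible`. Conversely, if the gain is below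
`γ`, homogeneity gives `‖y_p‖² ≤ q ‖y_r‖²` with some `q < γ` for all attacks of finite support
started at rest. The value function `V x = sup_a (‖y_p‖² - γ ‖y_r‖²)` over such attacks from the
initial state `x` is then finite, because the gap `γ - q` absorbs the cross terms. A finite partial
supremum of a quadratic form is again quadratic (`exists_symm_bilin_isLUB`), so `V x = xᵀ P x`, and
Bellman's inequality for `V` is the matrix inequality (`exists_sdpFeasible`). Stability puts the
outputs in `ℓ²` from every initial state, so no controllability is needed. Measurability. Attacks of
finite support already decide whether the gain is at most `q` (`oog_le_iff`), and for each horizon a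
countable dense set of them suffices. Sublevel sets of the impact are therefore countable
intersections of measurable sets. Probabilistic part. The empirical estimate is Hoeffding's
inequality for one event. If the sampled Value-at-Risk leaves its interval, the empirical frequency
is off by at least `ε₁` on one of two non-random events, `{f < VaR_{β+ε₁}}` or `{f ≤ VaR_{β-ε₁}}`.
Two one-sided Hoeffding bounds then suffice, and no uniform law over `γ` is needed. -/

/-! ### Quadratic functions -/

/-- A real function on a real vector space that satisfies the parallelogram law and is bounded on
segments is the diagonal of a symmetric bilinear form. -/
theorem exists_symm_bilin_of_parallelogram {X : Type*} [AddCommGroup X] [Module ℝ X] (V : X → ℝ)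
    (hpar : ∀ x y, V (x + y) + V (x - y) = 2 * V x + 2 * V y)
    (hbdd : ∀ x y, ∃ C, ∀ t : ℝ, |t| ≤ 1 → |V (x + t • y)| ≤ C) :
    ∃ P : X →ₗ[ℝ] X →ₗ[ℝ] ℝ, (∀ x y, P x y = P y x) ∧ ∀ x, P x x = V x := by
  have h0 : V 0 = 0 := by
    have := hpar 0 0
    simp only [add_zero, sub_zero] at this
    linarith
  have hneg : ∀ x, V (-x) = V x := fun x => by
    have := hpar 0 x
    simp only [zero_add, zero_sub] at this
    linarith
  set B : X → X → ℝ := fun x y => (V (x + y) - V (x - y)) / 4 with hB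
  have hsymm : ∀ x y, B x y = B y x := fun x y => by
    simp only [hB]
    rw [add_comm x y, ← neg_sub y x, hneg]
  -- The combination `h1 - h2 - h3 + h4` of parallelogram laws cancels `V (2x ± (y + z))`, `V (y +
  -- z)` and `V (y - z)`.
  have hadd : ∀ x y z, B x (y + z) = B x y + B x z := fun x y z => by
    have h1 := hpar (x + y) (x + z)
    have h2 := hpar (x - y) (x - z)
    have h3 := hpar x (x + (y + z))
    have h4 := hpar x (x - (y + z))
    rw [show x + y + (x + z) = x + (x + (y + z)) by abel, show x + y - (x + z) = y - z by abel]
      at h1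
    rw [show x - y + (x - z) = x + (x - (y + z)) by abel,
      show x - y - (x - z) = -(y - z) by abel, hneg] at h2
    rw [show x - (x + (y + z)) = -(y + z) by abel, hneg] at h3
    rw [show x - (x - (y + z)) = y + z by abel] at h4
    simp only [hB]
    linarith
  -- An additive map `ℝ → ℝ` that is bounded near `0` is continuous, hence linear.
  have hsmul : ∀ x (t : ℝ) y, B x (t • y) = t * B x y := fun x t y => by
    let f : ℝ →+ ℝ := AddMonoidHom.mk' (fun t => B x (t • y)) fun s t => by
      rw [add_smul, hadd]
    have hf : Continuous f := by
      refine f.continuous_of_isBounded_nhds_zero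
        (Metric.closedBall_mem_nhds (0 : ℝ) one_pos) ?_
      obtain ⟨C, hC⟩ := hbdd x y
      refine (Metric.isBounded_closedBall (x := (0 : ℝ)) (r := C)).subset ?_
      rintro _ ⟨s, hs, rfl⟩
      have hs : |s| ≤ 1 := by simpa using hs
      have h1 := abs_le.1 (hC s hs)
      have h2 := hC (-s) (by rwa [abs_neg])
      rw [neg_smul, ← sub_eq_add_neg] at h2
      have h2 := abs_le.1 h2
      rw [mem_closedBall_zero_iff, Real.norm_eq_abs]
      change |(V (x + s • y) - V (x - s • y)) / 4| ≤ C
      rw [abs_le]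
      constructor <;> linarith
    have := map_real_smul f hf t 1
    simpa [f] using this
  refine ⟨LinearMap.mk₂ ℝ B (fun x y z => ?_) (fun t x y => ?_) hadd (fun t x y => hsmul x t y),
    hsymm, fun x => ?_⟩
  · rw [hsymm, hadd, hsymm z, hsymm z]
  · rw [hsymm, hsmul, hsymm y, smul_eq_mul]
  · have := hpar x x
    simp only [sub_self, h0] at this
    simp only [LinearMap.mk₂_apply, hB, sub_self, h0]
    linarith

theorem norm_map_add_smul_le {X U H : Type*} [AddCommGroup X] [Module ℝ X] [AddCommGroup U]
    [Module ℝ U] [NormedAddCommGroup H] [NormedSpace ℝ H] (T : X × U →ₗ[ℝ] H) (x y : X) {t : ℝ}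
    (ht : |t| ≤ 1) : ‖T (x + t • y, 0)‖ ≤ ‖T (x, 0)‖ + ‖T (y, 0)‖ := by
  have : (x + t • y, (0 : U)) = (x, 0) + t • (y, 0) := by simp
  rw [this, map_add, map_smul]
  refine (norm_add_le _ _).trans (add_le_add le_rfl ?_)
  rw [norm_smul, Real.norm_eq_abs]
  exact mul_le_of_le_one_left (norm_nonneg _) ht

/-- If `‖F (0, u)‖² ≤ q ‖G (0, u)‖²` for all `u` and `q < γ`, then the partial supremum over `u` of
the quadratic form `‖F (x, u)‖² - γ ‖G (x, u)‖²` is finite and is a quadratic form in `x`. -/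
theorem exists_symm_bilin_isLUB {X U H₁ H₂ : Type*} [AddCommGroup X] [Module ℝ X]
    [AddCommGroup U] [Module ℝ U] [NormedAddCommGroup H₁] [InnerProductSpace ℝ H₁]
    [NormedAddCommGroup H₂] [InnerProductSpace ℝ H₂]
    (F : X × U →ₗ[ℝ] H₁) (G : X × U →ₗ[ℝ] H₂) {q γ : ℝ} (hq : 0 ≤ q) (hqγ : q < γ)
    (h : ∀ u, ‖F (0, u)‖ ^ 2 ≤ q * ‖G (0, u)‖ ^ 2) :
    ∃ P : X →ₗ[ℝ] X →ₗ[ℝ] ℝ, (∀ x y, P x y = P y x) ∧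
      ∀ x, IsLUB (Set.range fun u => ‖F (x, u)‖ ^ 2 - γ * ‖G (x, u)‖ ^ 2) (P x x) := by
  have hγ : 0 < γ - q := sub_pos.2 hqγ
  set Q : X → U → ℝ := fun x u => ‖F (x, u)‖ ^ 2 - γ * ‖G (x, u)‖ ^ 2 with hQ
  -- With `c = ‖F (x, 0)‖`, `d = ‖G (x, 0)‖` and `g = ‖G (0, u)‖`, the form is at most `(c + √q g)²
  -- - γ (g - d)²`. This is a concave quadratic in `g` with leading coefficient `-(γ - q)`; `K c d`
  -- is its maximum over real `g` plus the discarded `γ d²`.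
  let K : ℝ → ℝ → ℝ := fun c d => (√q * c + γ * d) ^ 2 / (γ - q) + c ^ 2
  have hKmono : ∀ {c d c' d'}, 0 ≤ c → 0 ≤ d → c ≤ c' → d ≤ d' → K c d ≤ K c' d' := by
    intro c d c' d' hc hd hcc hdd
    have : 0 ≤ γ := by linarith
    simp only [K]
    gcongr
  have hupper : ∀ x u, Q x u ≤ K ‖F (x, 0)‖ ‖G (x, 0)‖ := by
    intro x u
    have hsplit : (x, u) = (x, (0 : U)) + (0, u) := by simp
    have hF : ‖F (x, u)‖ ≤ ‖F (x, 0)‖ + √q * ‖G (0, u)‖ := by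
      rw [hsplit, map_add]
      refine (norm_add_le _ _).trans (add_le_add le_rfl ?_)
      refine abs_le_of_sq_le_sq' ?_ (by positivity) |>.2
      rw [mul_pow, Real.sq_sqrt hq]
      exact h u
    have hG : |‖G (0, u)‖ - ‖G (x, 0)‖| ≤ ‖G (x, u)‖ := by
      have := abs_norm_sub_norm_le (G (0, u)) (-G (x, 0))
      rwa [norm_neg, sub_neg_eq_add, add_comm (G (0, u)), ← map_add, ← hsplit] at this
    have hF2 : ‖F (x, u)‖ ^ 2 ≤ (‖F (x, 0)‖ + √q * ‖G (0, u)‖) ^ 2 := by gcongr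
    have hG2 : (‖G (0, u)‖ - ‖G (x, 0)‖) ^ 2 ≤ ‖G (x, u)‖ ^ 2 := by
      rw [← sq_abs]; gcongr
    have hG3 : γ * (‖G (0, u)‖ - ‖G (x, 0)‖) ^ 2 ≤ γ * ‖G (x, u)‖ ^ 2 :=
      mul_le_mul_of_nonneg_left hG2 (by linarith)
    simp only [hQ, K]
    set c := ‖F (x, 0)‖
    set d := ‖G (x, 0)‖
    set g := ‖G (0, u)‖
    have hsq : √q * √q = q := Real.mul_self_sqrt hq
    have hdiv : 2 * g * (√q * c + γ * d) - (γ - q) * g ^ 2 ≤ (√q * c + γ * d) ^ 2 / (γ - q) := by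
      rw [le_div_iff₀ hγ]
      nlinarith [sq_nonneg (√q * c + γ * d - (γ - q) * g)]
    have hd : 0 ≤ γ * d ^ 2 := mul_nonneg (by linarith) (sq_nonneg _)
    have : (c + √q * g) ^ 2 = c ^ 2 + 2 * √q * c * g + q * g ^ 2 := by
      linear_combination g ^ 2 * hsq
    nlinarith
  have hbdd : ∀ x, BddAbove (Set.range (Q x)) := fun x =>
    ⟨_, Set.forall_mem_range.2 (hupper x)⟩
  set V : X → ℝ := fun x => ⨆ u, Q x u with hV
  have hle : ∀ x u, Q x u ≤ V x := fun x u => le_ciSup (hbdd x) u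
  -- The form obeys the parallelogram law jointly in `(x, u)`. Taking suprema over `u` and `v`
  -- independently gives one inequality for `V`; the reverse one is the same inequality at `x + y`,
  -- `x - y`, combined with `V (2x) = 4 V x`.
  have hQpar : ∀ x y u v, Q (x + y) (u + v) + Q (x - y) (u - v) = 2 * Q x u + 2 * Q y v := by
    intro x y u v
    have h1 := parallelogram_law_with_norm ℝ (F (x, u)) (F (y, v))
    have h2 := parallelogram_law_with_norm ℝ (G (x, u)) (G (y, v))
    simp only [← map_add, ← map_sub, Prod.mk_add_mk, Prod.mk_sub_mk] at h1 h2
    simp only [hQ]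
    linear_combination h1 - γ * h2
  have hge : ∀ x y, 2 * V x + 2 * V y ≤ V (x + y) + V (x - y) := by
    intro x y
    have h1 : ∀ u v, 2 * Q x u + 2 * Q y v ≤ V (x + y) + V (x - y) := fun u v => by
      rw [← hQpar]
      exact add_le_add (hle _ _) (hle _ _)
    have h2 : ∀ v, V x ≤ (V (x + y) + V (x - y) - 2 * Q y v) / 2 := fun v =>
      ciSup_le fun u => by linarith [h1 u v]
    have h3 : V y ≤ (V (x + y) + V (x - y) - 2 * V x) / 2 :=
      ciSup_le fun v => by linarith [h2 v]
    linarith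
  have hscale : ∀ x, V ((2 : ℝ) • x) = 4 * V x := by
    have hQs : ∀ (t : ℝ) x u, Q (t • x) (t • u) = t ^ 2 * Q x u := fun t x u => by
      simp only [hQ, ← Prod.smul_mk, map_smul, norm_smul, mul_pow, Real.norm_eq_abs, sq_abs]
      ring
    intro x
    refine le_antisymm (ciSup_le fun u => ?_) ?_
    · have := hQs 2 x ((1 / 2 : ℝ) • u)
      rw [smul_smul, show (2 : ℝ) * (1 / 2) = 1 by norm_num, one_smul] at this
      rw [this]
      linarith [hle x ((1 / 2 : ℝ) • u)]
    · have : V x ≤ V ((2 : ℝ) • x) / 4 := ciSup_le fun u => by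
        have h1 := hle ((2 : ℝ) • x) ((2 : ℝ) • u)
        rw [hQs] at h1
        linarith
      linarith
  have hpar : ∀ x y, V (x + y) + V (x - y) = 2 * V x + 2 * V y := by
    intro x y
    refine le_antisymm ?_ (hge x y)
    have := hge (x + y) (x - y)
    rw [show x + y + (x - y) = (2 : ℝ) • x by rw [two_smul]; abel,
      show x + y - (x - y) = (2 : ℝ) • y by rw [two_smul]; abel, hscale, hscale] at this
    linarith
  obtain ⟨P, hP, hPV⟩ := exists_symm_bilin_of_parallelogram V hpar (by
    intro x y
    set c := ‖F (x, 0)‖ + ‖F (y, 0)‖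
    set d := ‖G (x, 0)‖ + ‖G (y, 0)‖
    -- The lower bound comes from the competitor `u = 0`, the upper one from monotonicity of `K`.
    refine ⟨K c d + γ * d ^ 2, fun t ht => abs_le.2 ⟨?_, ?_⟩⟩
    · have h1 := hle (x + t • y) 0
      have h2 : ‖G (x + t • y, 0)‖ ^ 2 ≤ d ^ 2 := by
        have := norm_map_add_smul_le G x y ht
        gcongr
      have h3 : γ * ‖G (x + t • y, 0)‖ ^ 2 ≤ γ * d ^ 2 :=
        mul_le_mul_of_nonneg_left h2 (by linarith)
      have h4 : 0 ≤ K c d := by simp only [K]; positivity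
      have h5 : 0 ≤ ‖F (x + t • y, 0)‖ ^ 2 := sq_nonneg _
      simp only [hQ] at h1
      linarith
    · have h1 : V (x + t • y) ≤ K c d := ciSup_le fun u => (hupper _ u).trans
        (hKmono (norm_nonneg _) (norm_nonneg _) (norm_map_add_smul_le F x y ht)
          (norm_map_add_smul_le G x y ht))
      have h2 : 0 ≤ γ * d ^ 2 := mul_nonneg (by linarith) (sq_nonneg _)
      linarith)
  refine ⟨P, hP, fun x => ?_⟩
  rw [hPV]
  exact isLUB_ciSup (hbdd x)

/-! ### Stable matrices -/

/-- The powers of an element of a complex Banach algebra whose spectrum lies in the open unit disc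
are summable in norm. -/
theorem summable_norm_pow_of_spectrum_lt_one {R : Type*} [NormedRing R] [NormedAlgebra ℂ R]
    [CompleteSpace R] (a : R) (h : ∀ z ∈ spectrum ℂ a, ‖z‖ < 1) :
    Summable fun k : ℕ => ‖a ^ k‖ := by
  cases subsingleton_or_nontrivial R with
  | inl hR =>
    have : (fun k : ℕ => ‖a ^ k‖) = fun _ => 0 := by
      funext k
      rw [Subsingleton.elim (a ^ k) 0, norm_zero]
    rw [this]
    exact summable_zero
  | inr hR =>
    have hρ : spectralRadius ℂ a < (1 : NNReal) :=
      spectrum.spectralRadius_lt_of_forall_lt a fun z hz => by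
        simpa [← NNReal.coe_lt_coe] using h z hz
    obtain ⟨r, hr1, hr2⟩ := ENNReal.lt_iff_exists_nnreal_btwn.1 hρ
    have hr2 : r < 1 := by exact_mod_cast hr2
    -- Gelfand's formula: eventually `‖a ^ k‖ < r ^ k` with `r < 1`.
    have hev := (spectrum.pow_nnnorm_pow_one_div_tendsto_nhds_spectralRadius a).eventually_lt_const
      hr1
    refine Summable.of_norm_bounded_eventually_nat
      (summable_geometric_of_lt_one r.coe_nonneg (by exact_mod_cast hr2)) ?_
    filter_upwards [hev, eventually_gt_atTop 0] with k hk hk0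
    rw [one_div, ENNReal.rpow_inv_lt_iff (by exact_mod_cast hk0), ENNReal.rpow_natCast] at hk
    have : ‖a ^ k‖₊ < r ^ k := by exact_mod_cast hk
    rw [norm_norm]
    exact_mod_cast this.le

open scoped Matrix.Norms.Operator in
/-- The free trajectories of a real matrix with all eigenvalues in the open unit disc are
summable. -/
theorem Matrix.summable_norm_pow_mulVec {n : Type*} [Fintype n] [DecidableEq n]
    (A : Matrix n n ℝ) (h : ∀ z ∈ spectrum ℂ (A.map (algebraMap ℝ ℂ)), ‖z‖ < 1) (x : n → ℝ) :
    Summable fun k : ℕ => ‖(A ^ k) *ᵥ x‖ := by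
  have hs := (summable_norm_pow_of_spectrum_lt_one _ h).mul_right ‖(algebraMap ℝ ℂ) ∘ x‖
  refine hs.of_nonneg_of_le (fun _ => norm_nonneg _) fun k => ?_
  have h1 : ‖(A ^ k) *ᵥ x‖ = ‖(algebraMap ℝ ℂ) ∘ ((A ^ k) *ᵥ x)‖ := by
    simp [Pi.norm_def]
  have h2 : (algebraMap ℝ ℂ) ∘ ((A ^ k) *ᵥ x) =
      (A.map (algebraMap ℝ ℂ) ^ k) *ᵥ ((algebraMap ℝ ℂ) ∘ x) := by
    funext i
    have := RingHom.map_mulVec (algebraMap ℝ ℂ) (A ^ k) x i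
    rw [Function.comp_apply, this, Matrix.map_pow]
  rw [h1, h2]
  exact Matrix.linfty_opNorm_mulVec _ _

/-! ### Trajectories and outputs from an arbitrary initial state -/

/-- The signals that vanish from some time on. -/
def eventuallyZero (m : Type*) : Submodule ℝ (ℕ → m → ℝ) where
  carrier := {a | ∀ᶠ k in atTop, a k = 0}
  add_mem' {a b} ha hb := by
    filter_upwards [ha, hb] with k h1 h2
    rw [Pi.add_apply, h1, h2, add_zero]
  zero_mem' := Eventually.of_forall fun _ => rfl
  smul_mem' t a ha := by
    filter_upwards [ha] with k h1
    rw [Pi.smul_apply, h1, smul_zero]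

theorem mem_eventuallyZero {m : Type*} {a : ℕ → m → ℝ} :
    a ∈ eventuallyZero m ↔ ∀ᶠ k in atTop, a k = 0 := Iff.rfl

/-- The attack that applies `u` first and then follows `a`. -/
def consSignal {m : Type*} (u : m → ℝ) (a : ℕ → m → ℝ) : ℕ → m → ℝ
  | 0 => u
  | k + 1 => a k

theorem consSignal_mem_eventuallyZero {m : Type*} {u : m → ℝ} {a : ℕ → m → ℝ}
    (ha : a ∈ eventuallyZero m) : consSignal u a ∈ eventuallyZero m := by
  obtain ⟨N, hN⟩ := eventually_atTop.1 (mem_eventuallyZero.1 ha)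
  refine eventually_atTop.2 ⟨N + 1, fun k hk => ?_⟩
  obtain ⟨j, rfl⟩ : ∃ j, k = j + 1 := ⟨k - 1, by omega⟩
  exact hN j (by omega)

/-- A finite sequence of inputs, continued by zero. -/
def extendByZero (m : Type*) (N : ℕ) : (Fin N → m → ℝ) →ₗ[ℝ] eventuallyZero m where
  toFun v := ⟨fun k => if h : k < N then v ⟨k, h⟩ else 0,
    eventually_atTop.2 ⟨N, fun k hk => dif_neg (by omega)⟩⟩
  map_add' v w := by
    ext k i
    by_cases h : k < N <;> simp [h]
  map_smul' t v := by
    ext k i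
    by_cases h : k < N <;> simp [h]

theorem exists_extendByZero_eq {m : Type*} (a : eventuallyZero m) :
    ∃ N v, extendByZero m N v = a := by
  obtain ⟨N, hN⟩ := eventually_atTop.1 (mem_eventuallyZero.1 a.2)
  refine ⟨N, fun k => a.1 k, ?_⟩
  ext k i
  by_cases h : k < N
  · simp [extendByZero, h]
  · simp [extendByZero, h, hN k (by omega)]

theorem norm_toLp_sq {q : Type*} [Fintype q] (y : q → ℝ) :
    ‖(WithLp.toLp 2 y : EuclideanSpace ℝ q)‖ ^ 2 = y ⬝ᵥ y := by
  rw [EuclideanSpace.real_norm_sq_eq]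
  simp [dotProduct, pow_two]

theorem dotProduct_self_nonneg_real {q : Type*} [Fintype q] (y : q → ℝ) : 0 ≤ y ⬝ᵥ y := by
  rw [← norm_toLp_sq]
  positivity

namespace AttackedSystem

variable {n m p r q : Type*} [Fintype n] [Fintype m]

/-- The state trajectory from the initial state `x₀`. -/
def stateFrom (S : AttackedSystem n m p r) (x₀ : n → ℝ) (a : ℕ → m → ℝ) : ℕ → n → ℝ
  | 0 => x₀
  | k + 1 => S.A *ᵥ S.stateFrom x₀ a k + S.B *ᵥ a k

/-- The output with matrices `C` and `D` along the trajectory from the initial state `x₀`. -/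
def outputFrom (S : AttackedSystem n m p r) (C : Matrix q n ℝ) (D : Matrix q m ℝ)
    (x₀ : n → ℝ) (a : ℕ → m → ℝ) (k : ℕ) : q → ℝ :=
  C *ᵥ S.stateFrom x₀ a k + D *ᵥ a k

theorem stateFrom_zero (S : AttackedSystem n m p r) (a : ℕ → m → ℝ) :
    S.stateFrom 0 a = S.state a := by
  funext k
  induction k with
  | zero => rfl
  | succ k ih => rw [stateFrom, state, ih]

theorem outputFrom_perf (S : AttackedSystem n m p r) (a : ℕ → m → ℝ) :
    S.outputFrom S.Cp S.Dp 0 a = S.perf a := by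
  funext k
  rw [outputFrom, perf, stateFrom_zero]

theorem outputFrom_resid (S : AttackedSystem n m p r) (a : ℕ → m → ℝ) :
    S.outputFrom S.Cr S.Dr 0 a = S.resid a := by
  funext k
  rw [outputFrom, resid, stateFrom_zero]

theorem stateFrom_add (S : AttackedSystem n m p r) (x y : n → ℝ) (a b : ℕ → m → ℝ) (k : ℕ) :
    S.stateFrom (x + y) (a + b) k = S.stateFrom x a k + S.stateFrom y b k := by
  induction k with
  | zero => rfl
  | succ k ih =>
    simp only [stateFrom, ih, Pi.add_apply, Matrix.mulVec_add]
    abel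

theorem stateFrom_smul (S : AttackedSystem n m p r) (t : ℝ) (x : n → ℝ) (a : ℕ → m → ℝ) (k : ℕ) :
    S.stateFrom (t • x) (t • a) k = t • S.stateFrom x a k := by
  induction k with
  | zero => rfl
  | succ k ih => simp only [stateFrom, ih, Pi.smul_apply, Matrix.mulVec_smul, smul_add]

theorem outputFrom_add (S : AttackedSystem n m p r) (C : Matrix q n ℝ) (D : Matrix q m ℝ)
    (x y : n → ℝ) (a b : ℕ → m → ℝ) (k : ℕ) :
    S.outputFrom C D (x + y) (a + b) k = S.outputFrom C D x a k + S.outputFrom C D y b k := by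
  simp only [outputFrom, stateFrom_add, Pi.add_apply, Matrix.mulVec_add]
  abel

theorem outputFrom_smul (S : AttackedSystem n m p r) (C : Matrix q n ℝ) (D : Matrix q m ℝ)
    (t : ℝ) (x : n → ℝ) (a : ℕ → m → ℝ) (k : ℕ) :
    S.outputFrom C D (t • x) (t • a) k = t • S.outputFrom C D x a k := by
  simp only [outputFrom, stateFrom_smul, Pi.smul_apply, Matrix.mulVec_smul, smul_add]

/-- Time invariance, the source of the Bellman inequality for the value function. -/
theorem stateFrom_consSignal (S : AttackedSystem n m p r) (x : n → ℝ) (u : m → ℝ)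
    (a : ℕ → m → ℝ) (k : ℕ) :
    S.stateFrom x (consSignal u a) (k + 1) = S.stateFrom (S.A *ᵥ x + S.B *ᵥ u) a k := by
  induction k with
  | zero => rfl
  | succ k ih => rw [stateFrom, ih, stateFrom, consSignal]

section Stable

variable [DecidableEq n] [Fintype q] {S : AttackedSystem n m p r}

/-- Once the input has died out, the trajectory is a free one and the summability of the powers of
`A` applies. -/
theorem summable_norm_stateFrom (hS : S.IsStable) (x : n → ℝ) {a : ℕ → m → ℝ}
    (ha : a ∈ eventuallyZero m) : Summable fun k => ‖S.stateFrom x a k‖ := by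
  obtain ⟨N, hN⟩ := eventually_atTop.1 (mem_eventuallyZero.1 ha)
  rw [← summable_nat_add_iff N]
  refine (S.A.summable_norm_pow_mulVec hS (S.stateFrom x a N)).congr fun k => ?_
  congr 1
  induction k with
  | zero => simp
  | succ k ih =>
    rw [add_right_comm, stateFrom, ← ih, hN _ (by omega), Matrix.mulVec_zero, add_zero, pow_succ',
      Matrix.mulVec_mulVec]

theorem memLp_outputFrom (hS : S.IsStable) (C : Matrix q n ℝ) (D : Matrix q m ℝ)
    (x : n → ℝ) {a : ℕ → m → ℝ} (ha : a ∈ eventuallyZero m) :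
    Memℓp (fun k => (WithLp.toLp 2 (S.outputFrom C D x a k) : EuclideanSpace ℝ q)) 2 := by
  -- The output is even in `ℓ¹`: its tail is bounded by a multiple of the summable state norms.
  refine Memℓp.of_exponent_ge (q := 1) (memℓp_gen ?_) (by norm_num)
  simp only [ENNReal.toReal_one, Real.rpow_one]
  obtain ⟨N, hN⟩ := eventually_atTop.1 (mem_eventuallyZero.1 ha)
  let T : (n → ℝ) →L[ℝ] EuclideanSpace ℝ q := LinearMap.toContinuousLinearMap
    ((WithLp.linearEquiv 2 ℝ (q → ℝ)).symm.toLinearMap ∘ₗ C.mulVecLin)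
  refine Summable.of_norm_bounded_eventually_nat
    ((summable_norm_stateFrom hS x ha).mul_left ‖T‖) (eventually_atTop.2 ⟨N, fun k hk => ?_⟩)
  rw [norm_norm, outputFrom, hN k hk, Matrix.mulVec_zero, add_zero]
  exact T.le_opNorm _

/-- The output of a stable system as a linear map into `ℓ²`, for signals that vanish from some
time on. -/
noncomputable def outputMap (hS : S.IsStable) (C : Matrix q n ℝ) (D : Matrix q m ℝ) :
    (n → ℝ) × eventuallyZero m →ₗ[ℝ] lp (fun _ : ℕ => EuclideanSpace ℝ q) 2 where
  toFun w := ⟨fun k => WithLp.toLp 2 (S.outputFrom C D w.1 w.2 k),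
    memLp_outputFrom hS C D w.1 w.2.2⟩
  map_add' w w' := by
    ext k : 2
    exact congrArg (WithLp.toLp 2) (S.outputFrom_add C D w.1 w'.1 w.2 w'.2 k)
  map_smul' t w := by
    ext k : 2
    exact congrArg (WithLp.toLp 2) (S.outputFrom_smul C D t w.1 w.2 k)

theorem hasSum_outputMap (hS : S.IsStable) (C : Matrix q n ℝ) (D : Matrix q m ℝ)
    (w : (n → ℝ) × eventuallyZero m) :
    HasSum (fun k => S.outputFrom C D w.1 w.2 k ⬝ᵥ S.outputFrom C D w.1 w.2 k)
      (‖outputMap hS C D w‖ ^ 2) := by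
  have := lp.hasSum_norm (p := 2) (by norm_num) (outputMap hS C D w)
  simp only [ENNReal.toReal_ofNat, Real.rpow_two] at this
  convert! this using 2 with k
  exact (norm_toLp_sq _).symm

theorem energy_outputFrom (hS : S.IsStable) (C : Matrix q n ℝ) (D : Matrix q m ℝ)
    (w : (n → ℝ) × eventuallyZero m) :
    energy (S.outputFrom C D w.1 w.2) = ENNReal.ofReal (‖outputMap hS C D w‖ ^ 2) := by
  have h := hasSum_outputMap hS C D w
  rw [energy, ← h.tsum_eq, ENNReal.ofReal_tsum_of_nonneg (fun k => dotProduct_self_nonneg_real _)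
    h.summable]

/-- Splitting off the first step of the output energy. -/
theorem norm_outputMap_consSignal_sq (hS : S.IsStable) (C : Matrix q n ℝ) (D : Matrix q m ℝ)
    (x : n → ℝ) (u : m → ℝ) (a : eventuallyZero m) :
    ‖outputMap hS C D (x, ⟨consSignal u a, consSignal_mem_eventuallyZero a.2⟩)‖ ^ 2 =
      (C *ᵥ x + D *ᵥ u) ⬝ᵥ (C *ᵥ x + D *ᵥ u) +
        ‖outputMap hS C D (S.A *ᵥ x + S.B *ᵥ u, a)‖ ^ 2 := by
  have h := hasSum_outputMap hS C D (x, ⟨consSignal u a, consSignal_mem_eventuallyZero a.2⟩)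
  rw [← h.tsum_eq, h.summable.tsum_eq_zero_add, ← (hasSum_outputMap hS C D (_, a)).tsum_eq]
  congr 1
  refine tsum_congr fun k => ?_
  simp only [outputFrom, stateFrom_consSignal]
  rfl

theorem continuous_energy_outputFrom (hS : S.IsStable) (C : Matrix q n ℝ) (D : Matrix q m ℝ)
    (N : ℕ) :
    Continuous fun v => energy (S.outputFrom C D 0 (extendByZero m N v)) := by
  let T := (outputMap hS C D) ∘ₗ (LinearMap.inr ℝ (n → ℝ) _) ∘ₗ extendByZero m N
  have hT : Continuous T := T.continuous_of_finiteDimensional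
  have : (fun v => energy (S.outputFrom C D 0 (extendByZero m N v))) =
      fun v => ENNReal.ofReal (‖T v‖ ^ 2) := by
    funext v
    exact energy_outputFrom hS C D (0, extendByZero m N v)
  rw [this]
  exact ENNReal.continuous_ofReal.comp (hT.norm.pow 2)

end Stable

end AttackedSystem

/-! ### The output-to-output gain and the semidefinite program -/

theorem Matrix.dotProduct_transpose_mul_mulVec {k n m : Type*} [Fintype k] [Fintype n] [Fintype m]
    (M : Matrix k n ℝ) (N : Matrix k m ℝ) (x : n → ℝ) (y : m → ℝ) :
    x ⬝ᵥ ((Mᵀ * N) *ᵥ y) = (M *ᵥ x) ⬝ᵥ (N *ᵥ y) := by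
  rw [← Matrix.mulVec_mulVec, Matrix.dotProduct_mulVec, Matrix.vecMul_transpose]

theorem AttackedSystem.isSymm_lmi {n m p r : Type*} [Fintype n] [Fintype p] [Fintype r]
    (S : AttackedSystem n m p r) (γ : ℝ)
    {P : Matrix n n ℝ} (hP : P.IsSymm) :
    (S.lmi γ P).IsSymm := by
  have hP' : Pᵀ = P := hP
  simp only [Matrix.IsSymm, lmi, Matrix.transpose_sub, Matrix.transpose_add,
    Matrix.fromBlocks_transpose, Matrix.transpose_smul, Matrix.transpose_mul,
    Matrix.transpose_transpose, hP', Matrix.mul_assoc]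

theorem AttackedSystem.energy_perf {n m p r : Type*} [Fintype n] [Fintype m] [Fintype p]
    [DecidableEq n] {S : AttackedSystem n m p r} (hS : S.IsStable) (a : eventuallyZero m) :
    energy (S.perf a) = ENNReal.ofReal (‖outputMap hS S.Cp S.Dp (0, a)‖ ^ 2) := by
  rw [← energy_outputFrom, outputFrom_perf]

theorem AttackedSystem.energy_resid {n m p r : Type*} [Fintype n] [Fintype m] [Fintype r]
    [DecidableEq n] {S : AttackedSystem n m p r} (hS : S.IsStable) (a : eventuallyZero m) :
    energy (S.resid a) = ENNReal.ofReal (‖outputMap hS S.Cr S.Dr (0, a)‖ ^ 2) := by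
  rw [← energy_outputFrom, outputFrom_resid]

namespace AttackedSystem

variable {n m p r : Type*} [Fintype n] [Fintype m] [Fintype p] [Fintype r]

theorem dotProduct_lmi_mulVec (S : AttackedSystem n m p r) (γ : ℝ) (P : Matrix n n ℝ)
    (x : n → ℝ) (u : m → ℝ) :
    Sum.elim x u ⬝ᵥ (S.lmi γ P *ᵥ Sum.elim x u) =
      (S.A *ᵥ x + S.B *ᵥ u) ⬝ᵥ (P *ᵥ (S.A *ᵥ x + S.B *ᵥ u)) - x ⬝ᵥ (P *ᵥ x)
      + (S.Cp *ᵥ x + S.Dp *ᵥ u) ⬝ᵥ (S.Cp *ᵥ x + S.Dp *ᵥ u)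
      - γ * ((S.Cr *ᵥ x + S.Dr *ᵥ u) ⬝ᵥ (S.Cr *ᵥ x + S.Dr *ᵥ u)) := by
  rw [lmi, Matrix.sub_mulVec, Matrix.add_mulVec, dotProduct_sub, dotProduct_add, Matrix.smul_mulVec,
    dotProduct_smul, Matrix.dotProduct_transpose_mul_mulVec, Matrix.dotProduct_transpose_mul_mulVec,
    Matrix.fromCols_mulVec_sumElim, Matrix.fromCols_mulVec_sumElim, smul_eq_mul,
    Matrix.fromBlocks_mulVec]
  congr 2
  simp only [Sum.elim_comp_inl, Sum.elim_comp_inr, sumElim_dotProduct_sumElim, dotProduct_add,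
    Matrix.sub_mulVec, dotProduct_sub, Matrix.mul_assoc, Matrix.dotProduct_transpose_mul_mulVec,
    Matrix.mulVec_add, add_dotProduct, Matrix.mulVec_mulVec]
  ring

/-- The matrix inequality is the dissipation inequality for the storage function `x ↦ xᵀ P x`. -/
theorem sdpFeasible_iff (S : AttackedSystem n m p r) (γ : ℝ) (P : Matrix n n ℝ) :
    S.SDPFeasible γ P ↔ 0 ≤ γ ∧ P.IsSymm ∧ ∀ x u,
      (S.A *ᵥ x + S.B *ᵥ u) ⬝ᵥ (P *ᵥ (S.A *ᵥ x + S.B *ᵥ u))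
        + (S.Cp *ᵥ x + S.Dp *ᵥ u) ⬝ᵥ (S.Cp *ᵥ x + S.Dp *ᵥ u) ≤
      x ⬝ᵥ (P *ᵥ x) + γ * ((S.Cr *ᵥ x + S.Dr *ᵥ u) ⬝ᵥ (S.Cr *ᵥ x + S.Dr *ᵥ u)) := by
  refine and_congr_right fun _ => and_congr_right fun hP => ?_
  have hherm : (-(S.lmi γ P)).IsHermitian := by
    rw [Matrix.IsHermitian, Matrix.conjTranspose_eq_transpose_of_trivial, Matrix.transpose_neg,
      S.isSymm_lmi γ hP]
  rw [Matrix.posSemidef_iff_dotProduct_mulVec]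
  simp only [hherm, true_and, star_trivial, Matrix.neg_mulVec, dotProduct_neg]
  constructor
  · intro h x u
    have := h (Sum.elim x u)
    rw [dotProduct_lmi_mulVec] at this
    linarith
  · intro h z
    have := h (z ∘ Sum.inl) (z ∘ Sum.inr)
    rw [← Sum.elim_comp_inl_inr z, dotProduct_lmi_mulVec]
    linarith

/-- Telescoping the dissipation inequality leaves only the terminal term `x[K]ᵀ P x[K]`. As `P` may
be indefinite, its sign is unknown; it disappears in the limit because admissible attacks have `x[k]
→ 0`. -/
theorem oog_le_of_sdpFeasible {S : AttackedSystem n m p r} {γ : ℝ} {P : Matrix n n ℝ}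
    (h : S.SDPFeasible γ P) : S.oog ≤ ENNReal.ofReal γ := by
  obtain ⟨hγ, -, hdiss⟩ := (S.sdpFeasible_iff γ P).1 h
  refine iSup_le fun a => ?_
  by_cases ha : S.Stealthy a
  swap
  · simp [impact, ha]
  obtain ⟨hr, hx⟩ := ha
  rw [impact, if_pos ⟨hr, hx⟩, mul_one]
  have hsum : ∀ K, ∑ k ∈ Finset.range K, S.perf a k ⬝ᵥ S.perf a k ≤
      γ * ∑ k ∈ Finset.range K, S.resid a k ⬝ᵥ S.resid a k
        - S.state a K ⬝ᵥ (P *ᵥ S.state a K) := by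
    intro K
    induction K with
    | zero => simp [state]
    | succ K ih =>
      have := hdiss (S.state a K) (a K)
      rw [Finset.sum_range_succ, Finset.sum_range_succ, state]
      simp only [perf, resid] at ih ⊢
      linarith
  have hres : ∀ K, ∑ k ∈ Finset.range K, S.resid a k ⬝ᵥ S.resid a k ≤ 1 := by
    intro K
    have := (ENNReal.sum_le_tsum (f := fun k => ENNReal.ofReal (S.resid a k ⬝ᵥ S.resid a k))
      (Finset.range K)).trans hr
    rwa [← ENNReal.ofReal_sum_of_nonneg fun _ _ => dotProduct_self_nonneg_real _,
      ENNReal.ofReal_le_one] at this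
  have hlim : Tendsto (fun K => ENNReal.ofReal (γ - S.state a K ⬝ᵥ (P *ᵥ S.state a K))) atTop
      (𝓝 (ENNReal.ofReal γ)) := by
    refine ENNReal.tendsto_ofReal ?_
    have hcont : Continuous fun x : n → ℝ => γ - x ⬝ᵥ (P *ᵥ x) := by fun_prop
    have := (hcont.tendsto 0).comp hx
    simpa [Function.comp_def] using this
  refine le_of_tendsto_of_tendsto' (ENNReal.tendsto_nat_tsum _) hlim fun K => ?_
  rw [← ENNReal.ofReal_sum_of_nonneg fun _ _ => dotProduct_self_nonneg_real _]
  refine ENNReal.ofReal_le_ofReal ((hsum K).trans ?_)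
  have := mul_le_mul_of_nonneg_left (hres K) hγ
  linarith

section Stable

variable [DecidableEq n] {S : AttackedSystem n m p r}

/-- Both energies scale by `t²` under `a ↦ t • a`, so the normalised bound becomes a homogeneous
one. -/
theorem sq_norm_perf_le_of_oog_le (hS : S.IsStable) {q : ℝ} (hq : 0 ≤ q)
    (h : S.oog ≤ ENNReal.ofReal q) (a : eventuallyZero m) :
    ‖outputMap hS S.Cp S.Dp (0, a)‖ ^ 2 ≤ q * ‖outputMap hS S.Cr S.Dr (0, a)‖ ^ 2 := by
  have key : ∀ t : ℝ, t ^ 2 * ‖outputMap hS S.Cr S.Dr (0, a)‖ ^ 2 ≤ 1 →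
      t ^ 2 * ‖outputMap hS S.Cp S.Dp (0, a)‖ ^ 2 ≤ q := by
    intro t ht
    have hs : ((0 : n → ℝ), t • a) = t • ((0 : n → ℝ), a) := by simp
    have hstealthy : S.Stealthy (t • a : eventuallyZero m) := by
      constructor
      · rw [energy_resid hS, hs, map_smul, norm_smul, mul_pow, Real.norm_eq_abs, sq_abs]
        exact ENNReal.ofReal_le_one.2 ht
      · have := (summable_norm_stateFrom hS 0 (t • a).2).tendsto_atTop_zero
        rw [stateFrom_zero] at this
        exact tendsto_zero_iff_norm_tendsto_zero.2 this
    have := (le_iSup S.impact (t • a : eventuallyZero m)).trans h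
    rw [impact, if_pos hstealthy, mul_one, energy_perf hS, hs, map_smul, norm_smul, mul_pow,
      Real.norm_eq_abs, sq_abs] at this
    exact (ENNReal.ofReal_le_ofReal_iff hq).1 this
  set f := ‖outputMap hS S.Cp S.Dp (0, a)‖
  set g := ‖outputMap hS S.Cr S.Dr (0, a)‖ with hg
  -- With zero residual every multiple of the attack is stealthy, so a nonzero output could be
  -- scaled to energy `q + 1`. Otherwise `t = g⁻¹` makes the residual energy exactly `1`.
  rcases (norm_nonneg _ : 0 ≤ g).eq_or_lt with h0 | h0
  · rw [← hg] at h0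
    rw [← h0] at key ⊢
    by_contra! hf
    have hf : 0 < f ^ 2 := by simpa using hf
    have := key (√((q + 1) / f ^ 2)) (by simp)
    rw [Real.sq_sqrt (by positivity), div_mul_cancel₀ _ hf.ne'] at this
    linarith
  · rw [← hg] at h0
    have := key g⁻¹ (by rw [inv_pow, inv_mul_cancel₀ (by positivity)])
    rwa [inv_pow, inv_mul_le_iff₀ (by positivity), mul_comm] at this

theorem exists_sdpFeasible (hS : S.IsStable) {q γ : ℝ} (hq : 0 ≤ q) (hqγ : q < γ)
    (h : ∀ a : eventuallyZero m,
      ‖outputMap hS S.Cp S.Dp (0, a)‖ ^ 2 ≤ q * ‖outputMap hS S.Cr S.Dr (0, a)‖ ^ 2) :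
    ∃ P, S.SDPFeasible γ P := by
  obtain ⟨b, hb, hlub⟩ := exists_symm_bilin_isLUB (outputMap hS S.Cp S.Dp)
    (outputMap hS S.Cr S.Dr) hq hqγ h
  have hbP : ∀ x y, x ⬝ᵥ (LinearMap.toMatrix₂' ℝ b *ᵥ y) = b x y := fun x y => by
    rw [← Matrix.toLinearMap₂'_apply', Matrix.toLinearMap₂'_toMatrix']
  refine ⟨LinearMap.toMatrix₂' ℝ b, (S.sdpFeasible_iff _ _).2 ⟨hq.trans hqγ.le, ?_, ?_⟩⟩
  · ext i j
    rw [Matrix.transpose_apply, LinearMap.toMatrix₂'_apply, LinearMap.toMatrix₂'_apply, hb]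
  · intro x u
    rw [hbP, hbP]
    have : b (S.A *ᵥ x + S.B *ᵥ u) (S.A *ᵥ x + S.B *ᵥ u) ≤ b x x
        - (S.Cp *ᵥ x + S.Dp *ᵥ u) ⬝ᵥ (S.Cp *ᵥ x + S.Dp *ᵥ u)
        + γ * ((S.Cr *ᵥ x + S.Dr *ᵥ u) ⬝ᵥ (S.Cr *ᵥ x + S.Dr *ᵥ u)) := by
      -- Bellman's inequality: applying `u` and then following `a` from the next state is one
      -- competitor in the supremum at `x`.
      refine (hlub _).2 (Set.forall_mem_range.2 fun a => ?_)
      have := (hlub x).1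
        (Set.mem_range_self ⟨consSignal u a, consSignal_mem_eventuallyZero a.2⟩)
      simp only [norm_outputMap_consSignal_sq] at this
      linarith
    linarith

theorem exists_sdpFeasible_of_oog_lt (hS : S.IsStable) {γ : ℝ} (h : S.oog < ENNReal.ofReal γ) :
    ∃ P, S.SDPFeasible γ P := by
  obtain ⟨q, hq1, hq2⟩ := ENNReal.lt_iff_exists_nnreal_btwn.1 h
  have hq2 : (q : ℝ) < γ := by 
    rwa [← ENNReal.ofReal_coe_nnreal, ENNReal.ofReal_lt_ofReal_iff_of_nonneg q.coe_nonneg] at hq2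
  exact exists_sdpFeasible hS q.coe_nonneg hq2
    (sq_norm_perf_le_of_oog_le hS q.coe_nonneg (by rw [ENNReal.ofReal_coe_nnreal]; exact hq1.le))

/-- Strong duality: the output-to-output gain of a stable system is the value of the semidefinite
program. -/
theorem oog_eq_sdpValue (hS : S.IsStable) : (S.oog : EReal) = S.sdpValue := by
  apply le_antisymm
  · refine le_sInf ?_
    rintro _ ⟨γ, ⟨P, hP⟩, rfl⟩
    have := EReal.coe_ennreal_le_coe_ennreal_iff.2 (oog_le_of_sdpFeasible hP)
    rwa [EReal.coe_ennreal_ofReal, max_eq_left hP.1] at this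
  · refine EReal.le_of_forall_lt_iff_le.1 fun z hz => ?_
    have hz0 : 0 ≤ z := by
      have := (EReal.coe_ennreal_nonneg S.oog).trans hz.le
      exact_mod_cast this
    refine sInf_le ⟨z, exists_sdpFeasible_of_oog_lt hS ?_, rfl⟩
    rw [← EReal.coe_ennreal_lt_coe_ennreal_iff, EReal.coe_ennreal_ofReal, max_eq_left hz0]
    exact hz

/-- Passing from attacks of finite support to all attacks goes through the semidefinite program: the
bound yields a feasible `P` for every `γ > q`, and weak duality then covers every attack. -/
theorem oog_le_iff (hS : S.IsStable) (q : NNReal) :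
    S.oog ≤ q ↔ ∀ a ∈ eventuallyZero m, energy (S.perf a) ≤ q * energy (S.resid a) := by
  have hq : ∀ a : eventuallyZero m, energy (S.perf a) ≤ q * energy (S.resid a) ↔
      ‖outputMap hS S.Cp S.Dp (0, a)‖ ^ 2 ≤ q * ‖outputMap hS S.Cr S.Dr (0, a)‖ ^ 2 := by
    intro a
    rw [energy_perf hS, energy_resid hS, ← ENNReal.ofReal_coe_nnreal,
      ← ENNReal.ofReal_mul q.coe_nonneg, ENNReal.ofReal_le_ofReal_iff (by positivity)]
  constructor
  · intro h a ha
    exact (hq ⟨a, ha⟩).2 (sq_norm_perf_le_of_oog_le hS q.coe_nonneg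
      (by rwa [ENNReal.ofReal_coe_nnreal]) ⟨a, ha⟩)
  · intro h
    refine le_of_forall_gt_imp_ge_of_dense fun c hc => ?_
    obtain ⟨γ, hγ1, hγ2⟩ := ENNReal.lt_iff_exists_nnreal_btwn.1 hc
    obtain ⟨P, hP⟩ := exists_sdpFeasible hS (γ := γ) q.coe_nonneg (by exact_mod_cast hγ1)
      fun a => (hq a).1 (h a a.2)
    have := oog_le_of_sdpFeasible hP
    rw [ENNReal.ofReal_coe_nnreal] at this
    exact this.trans hγ2.le

/-- Countably many attacks decide whether the output-to-output gain is at most `q`. -/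
theorem oog_le_iff_denseSeq (hS : S.IsStable) (q : NNReal) :
    S.oog ≤ q ↔ ∀ N i, energy (S.perf (extendByZero m N (TopologicalSpace.denseSeq _ i))) ≤
      q * energy (S.resid (extendByZero m N (TopologicalSpace.denseSeq _ i))) := by
  rw [oog_le_iff hS]
  constructor
  · exact fun h N i => h _ (Subtype.property _)
  · intro h a ha
    obtain ⟨N, v, hv⟩ := exists_extendByZero_eq ⟨a, ha⟩
    have hva : (extendByZero m N v : ℕ → m → ℝ) = a := congrArg Subtype.val hv
    rw [← hva]
    have hp := continuous_energy_outputFrom hS S.Cp S.Dp N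
    have hr := continuous_energy_outputFrom hS S.Cr S.Dr N
    simp only [outputFrom_perf] at hp
    simp only [outputFrom_resid] at hr
    -- On a fixed horizon both energies are continuous in the finitely many inputs, so the
    -- inequality is a closed condition.
    exact (TopologicalSpace.denseRange_denseSeq _).induction_on v
      (isClosed_le hp ((ENNReal.continuous_const_mul ENNReal.coe_ne_top).comp hr)) (h N)

end Stable

end AttackedSystem

/-! ### Measurability of the worst-case impact -/

/-- A matrix-valued function with measurable entries. -/
def EntrywiseMeasurable {Ω : Type*} [MeasurableSpace Ω] {k l : Type*} (M : Ω → Matrix k l ℝ) :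
    Prop :=
  ∀ i j, Measurable fun δ => M δ i j

namespace EntrywiseMeasurable

variable {Ω : Type*} [MeasurableSpace Ω] {k k' l l' : Type*}

theorem const (M : Matrix k l ℝ) : EntrywiseMeasurable fun _ : Ω => M :=
  fun _ _ => measurable_const

theorem add {M N : Ω → Matrix k l ℝ} (hM : EntrywiseMeasurable M) (hN : EntrywiseMeasurable N) :
    EntrywiseMeasurable fun δ => M δ + N δ :=
  fun i j => (hM i j).add (hN i j)

theorem mul [Fintype k'] {M : Ω → Matrix k k' ℝ} {N : Ω → Matrix k' l ℝ}
    (hM : EntrywiseMeasurable M) (hN : EntrywiseMeasurable N) :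
    EntrywiseMeasurable fun δ => M δ * N δ :=
  fun i j => by
    simp only [Matrix.mul_apply]
    exact Finset.measurable_fun_sum _ fun c _ => (hM i c).mul (hN c j)

theorem fromCols {M : Ω → Matrix k l ℝ} {N : Ω → Matrix k l' ℝ} (hM : EntrywiseMeasurable M)
    (hN : EntrywiseMeasurable N) : EntrywiseMeasurable fun δ => Matrix.fromCols (M δ) (N δ)
  | i, Sum.inl j => hM i j
  | i, Sum.inr j => hN i j

theorem fromRows {M : Ω → Matrix k l ℝ} {N : Ω → Matrix k' l ℝ} (hM : EntrywiseMeasurable M)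
    (hN : EntrywiseMeasurable N) : EntrywiseMeasurable fun δ => Matrix.fromRows (M δ) (N δ)
  | Sum.inl i, j => hM i j
  | Sum.inr i, j => hN i j

theorem fromBlocks {M₁₁ : Ω → Matrix k l ℝ} {M₁₂ : Ω → Matrix k l' ℝ} {M₂₁ : Ω → Matrix k' l ℝ}
    {M₂₂ : Ω → Matrix k' l' ℝ} (h₁₁ : EntrywiseMeasurable M₁₁) (h₁₂ : EntrywiseMeasurable M₁₂)
    (h₂₁ : EntrywiseMeasurable M₂₁) (h₂₂ : EntrywiseMeasurable M₂₂) :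
    EntrywiseMeasurable fun δ => Matrix.fromBlocks (M₁₁ δ) (M₁₂ δ) (M₂₁ δ) (M₂₂ δ)
  | Sum.inl i, Sum.inl j => h₁₁ i j
  | Sum.inl i, Sum.inr j => h₁₂ i j
  | Sum.inr i, Sum.inl j => h₂₁ i j
  | Sum.inr i, Sum.inr j => h₂₂ i j

theorem mulVec [Fintype l] {M : Ω → Matrix k l ℝ} {v : Ω → l → ℝ} (hM : EntrywiseMeasurable M)
    (hv : Measurable v) : Measurable fun δ => M δ *ᵥ v δ :=
  measurable_pi_lambda _ fun i =>
    Finset.measurable_fun_sum _ fun j _ => (hM i j).mul (measurable_pi_iff.1 hv j)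

end EntrywiseMeasurable

theorem measurable_energy {Ω : Type*} [MeasurableSpace Ω] {q : Type*} [Fintype q]
    {y : Ω → ℕ → q → ℝ} (hy : ∀ k, Measurable fun δ => y δ k) :
    Measurable fun δ => energy (y δ) :=
  Measurable.tsum fun k => ENNReal.measurable_ofReal.comp <|
    Finset.measurable_fun_sum _ fun i _ =>
      (measurable_pi_iff.1 (hy k) i).mul (measurable_pi_iff.1 (hy k) i)

namespace AttackedSystem

variable {Ω : Type*} [MeasurableSpace Ω] {n m p r : Type*} [Fintype n] [Fintype m]

theorem measurable_state {S : Ω → AttackedSystem n m p r}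
    (hA : EntrywiseMeasurable fun δ => (S δ).A) (hB : EntrywiseMeasurable fun δ => (S δ).B)
    (a : ℕ → m → ℝ) (k : ℕ) : Measurable fun δ => (S δ).state a k := by
  induction k with
  | zero => exact measurable_const
  | succ k ih => exact (hA.mulVec ih).add (hB.mulVec measurable_const)

theorem measurable_oog [Fintype p] [Fintype r] [DecidableEq n] {S : Ω → AttackedSystem n m p r}
    (hS : ∀ δ, (S δ).IsStable)
    (hA : EntrywiseMeasurable fun δ => (S δ).A) (hB : EntrywiseMeasurable fun δ => (S δ).B)
    (hCp : EntrywiseMeasurable fun δ => (S δ).Cp) (hDp : EntrywiseMeasurable fun δ => (S δ).Dp)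
    (hCr : EntrywiseMeasurable fun δ => (S δ).Cr) (hDr : EntrywiseMeasurable fun δ => (S δ).Dr) :
    Measurable fun δ => (S δ).oog := by
  refine measurable_of_Iic fun c => ?_
  induction c with
  | top => simp
  | coe q =>
    have : (fun δ => (S δ).oog) ⁻¹' Set.Iic (q : ℝ≥0∞) = ⋂ N, ⋂ i, {δ |
        energy ((S δ).perf (extendByZero m N (TopologicalSpace.denseSeq _ i))) ≤
          q * energy ((S δ).resid (extendByZero m N (TopologicalSpace.denseSeq _ i)))} := by
      ext δ
      simp only [Set.mem_preimage, Set.mem_Iic, Set.mem_iInter, Set.mem_ofPred_eq]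
      exact oog_le_iff_denseSeq (hS δ) q
    rw [this]
    refine MeasurableSet.iInter fun N => MeasurableSet.iInter fun i => measurableSet_le ?_ ?_
    · exact measurable_energy fun k =>
        (hCp.mulVec (measurable_state hA hB _ k)).add (hDp.mulVec measurable_const)
    · exact (measurable_energy fun k =>
        (hCr.mulVec (measurable_state hA hB _ k)).add (hDr.mulVec measurable_const)).const_mul _

end AttackedSystem

theorem UncertainLoop.measurable_worstImpact {Ω : Type*} [MeasurableSpace Ω]
    {nx nz ns nu nm np nr na : ℕ} {L : UncertainLoop Ω nx nz ns nu nm np nr na}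
    (hL : L.IsMeasurable) (hS : ∀ δ, (L.closedLoop δ).IsStable) : Measurable L.worstImpact := by
  obtain ⟨hA, hB, hC, hCJ, hDJ⟩ := hL
  replace hA : EntrywiseMeasurable L.A := hA
  replace hB : EntrywiseMeasurable L.B := hB
  replace hC : EntrywiseMeasurable L.C := hC
  replace hCJ : EntrywiseMeasurable L.CJ := hCJ
  replace hDJ : EntrywiseMeasurable L.DJ := hDJ
  have hc : ∀ {k l : ℕ} (M : Matrix (Fin k) (Fin l) ℝ), EntrywiseMeasurable fun _ : Ω => M :=
    fun M => .const M
  refine Measurable.coe_ereal_ennreal (AttackedSystem.measurable_oog hS ?_ ?_ ?_ ?_ ?_ ?_)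
  · exact .fromBlocks (hA.add ((hB.mul (hc L.Dc)).mul hC))
      ((hB.mul (hc L.Cc)).fromCols (hc 0))
      (((hc L.Bc).mul hC).fromRows ((hc (L.Be * L.Dc + L.Ke)).mul hC)) (.const _)
  · exact ((hB.mul (hc L.Ba)).add ((hB.mul (hc L.Dc)).mul (hc L.Da))).fromRows (.const _)
  · exact (hCJ.add ((hDJ.mul (hc L.Dc)).mul hC)).fromCols
      ((hDJ.mul (hc L.Cc)).fromCols (hc 0))
  · exact hDJ.mul (hc _)
  · exact ((hc (L.De * L.Dc + L.Ee)).mul hC).fromCols (.const _)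
  · exact .const _

/-! ### Hoeffding's inequality for empirical frequencies -/

/-- The fraction of the points `y i` that lie in `D`. -/
noncomputable def empiricalFreq {Ω : Type*} {N : ℕ} (D : Set Ω) (y : Fin N → Ω) : ℝ :=
  (1 / (N : ℝ)) * ∑ i, D.indicator (fun _ => (1 : ℝ)) (y i)

theorem empiricalFreq_mono {Ω : Type*} {N : ℕ} {D D' : Set Ω} (h : D ⊆ D') (y : Fin N → Ω) :
    empiricalFreq D y ≤ empiricalFreq D' y := by
  refine mul_le_mul_of_nonneg_left (Finset.sum_le_sum fun i _ => ?_) (by positivity)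
  exact Set.indicator_le_indicator_of_subset h (fun _ => zero_le_one) _

theorem empiricalFreq_compl {Ω : Type*} {N : ℕ} (hN : 0 < N) (D : Set Ω) (y : Fin N → Ω) :
    empiricalFreq Dᶜ y = 1 - empiricalFreq D y := by
  have hN' : (N : ℝ) ≠ 0 := by exact_mod_cast hN.ne'
  have : ∀ d, Dᶜ.indicator (fun _ => (1 : ℝ)) d = 1 - D.indicator (fun _ => (1 : ℝ)) d := by
    intro d
    by_cases hd : d ∈ D <;> simp [hd]
  simp only [empiricalFreq, this, Finset.sum_sub_distrib, mul_sub]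
  simp [hN']

section Hoeffding

variable {Ω S : Type*} [MeasurableSpace Ω] [MeasurableSpace S] {PΩ : Measure Ω} {Pr : Measure S}
  [IsProbabilityMeasure Pr] {N : ℕ} {δ : Fin N → S → Ω}

theorem measureReal_empiricalFreq_sub_ge_le (hlaw : ∀ i, HasLaw (δ i) PΩ Pr)
    (hind : iIndepFun δ Pr) {D : Set Ω} (hD : MeasurableSet D) {ε : ℝ} (hε : 0 ≤ ε) :
    Pr.real {ω | ε ≤ empiricalFreq D (fun i => δ i ω) - PΩ.real D} ≤
      Real.exp (-2 * N * ε ^ 2) := by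
  -- Without samples the right-hand side is `exp 0 = 1`.
  rcases N.eq_zero_or_pos with rfl | hN
  · simp
  have hN' : (0 : ℝ) < N := by exact_mod_cast hN
  set f : Ω → ℝ := fun d => D.indicator (fun _ => (1 : ℝ)) d - PΩ.real D with hf
  have hfm : Measurable f := (measurable_const.indicator hD).sub_const _
  have hindf : iIndepFun (fun i => f ∘ δ i) Pr := hind.comp (fun _ => f) fun _ => hfm
  -- Hoeffding's lemma: a centred variable with values in an interval of length `1` has variance
  -- proxy `1/4`, so the exponent is `-(N ε)² / (2 N / 4) = -2 N ε²`.
  have hsub : ∀ i ∈ Finset.univ, HasSubgaussianMGF (f ∘ δ i) ((‖(1 : ℝ) - 0‖₊ / 2) ^ 2) Pr := by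
    intro i _
    have hm : Measurable fun d => D.indicator (fun _ => (1 : ℝ)) d := measurable_const.indicator hD
    have hint : Pr[fun ω => D.indicator (fun _ => (1 : ℝ)) (δ i ω)] = PΩ.real D := by
      have := (hlaw i).integral_comp (f := fun d => D.indicator (fun _ => (1 : ℝ)) d)
        hm.aestronglyMeasurable
      refine this.trans ?_
      rw [integral_indicator_const _ hD, smul_eq_mul, mul_one]
    have := hasSubgaussianMGF_of_mem_Icc (μ := Pr) (a := 0) (b := 1)
      (X := fun ω => D.indicator (fun _ => (1 : ℝ)) (δ i ω))
      (hm.comp_aemeasurable (hlaw i).aemeasurable) (Eventually.of_forall fun ω => by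
        by_cases h : δ i ω ∈ D <;> simp [h])
    rwa [hint] at this
  have key := HasSubgaussianMGF.measure_sum_ge_le_of_iIndepFun hindf hsub
    (mul_nonneg hN'.le hε)
  refine (measureReal_mono fun ω hω => ?_).trans (key.trans (Real.exp_le_exp.2 (le_of_eq ?_)))
  · have hω : ε ≤ empiricalFreq D (fun i => δ i ω) - PΩ.real D := hω
    change N * ε ≤ ∑ i, f (δ i ω)
    simp only [hf, Finset.sum_sub_distrib, Finset.sum_const, Finset.card_univ, Fintype.card_fin,
      nsmul_eq_mul]
    rw [empiricalFreq, one_div, le_sub_iff_add_le, le_inv_mul_iff₀ hN'] at hω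
    linarith
  · simp
    field_simp

theorem measureReal_sub_empiricalFreq_ge_le [IsProbabilityMeasure PΩ]
    (hlaw : ∀ i, HasLaw (δ i) PΩ Pr) (hind : iIndepFun δ Pr) {D : Set Ω}
    (hD : MeasurableSet D) {ε : ℝ} (hε : 0 ≤ ε) :
    Pr.real {ω | ε ≤ PΩ.real D - empiricalFreq D (fun i => δ i ω)} ≤
      Real.exp (-2 * N * ε ^ 2) := by
  rcases N.eq_zero_or_pos with rfl | hN
  · simp
  -- The lower tail for `D` is the upper tail for its complement.
  convert! measureReal_empiricalFreq_sub_ge_le hlaw hind hD.compl hε using 5 with ω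
  rw [empiricalFreq_compl hN, probReal_compl_eq_one_sub hD]
  ring

theorem measureReal_abs_sub_empiricalFreq_ge_le [IsProbabilityMeasure PΩ]
    (hlaw : ∀ i, HasLaw (δ i) PΩ Pr) (hind : iIndepFun δ Pr) {D : Set Ω}
    (hD : MeasurableSet D) {ε : ℝ} (hε : 0 ≤ ε) :
    Pr.real {ω | ε ≤ |PΩ.real D - empiricalFreq D (fun i => δ i ω)|} ≤
      2 * Real.exp (-2 * N * ε ^ 2) := by
  rw [two_mul]
  refine le_trans ?_ (add_le_add (measureReal_sub_empiricalFreq_ge_le hlaw hind hD hε)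
    (measureReal_empiricalFreq_sub_ge_le hlaw hind hD hε))
  refine (measureReal_mono fun ω hω => ?_).trans (measureReal_union_le _ _)
  rcases le_abs.1 (show ε ≤ |_| from hω) with h | h
  · exact Or.inl h
  · exact Or.inr (by rwa [neg_sub] at h)

end Hoeffding

theorem two_mul_exp_le_of_sample_size {ε β : ℝ} {N : ℕ} (hε : 0 < ε) (hβ : 0 < β)
    (hN : 1 / (2 * ε ^ 2) * Real.log (2 / β) ≤ N) : 2 * Real.exp (-2 * N * ε ^ 2) ≤ β := by
  rw [one_div, inv_mul_le_iff₀ (by positivity)] at hN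
  have h : Real.exp (-2 * N * ε ^ 2) ≤ Real.exp (-Real.log (2 / β)) :=
    Real.exp_le_exp.2 (by linarith)
  rw [Real.exp_neg, Real.exp_log (by positivity), inv_div] at h
  linarith

/-! ### Value-at-Risk -/

section ValueAtRisk

variable {Ω : Type*} [MeasurableSpace Ω] {μ : Measure Ω} {X : Ω → EReal}

theorem valueAtRisk_antitone (μ : Measure Ω) (X : Ω → EReal) : Antitone (valueAtRisk μ X) := by
  intro b b' h
  refine sInf_le_sInf (Set.image_mono fun x hx => ?_)
  exact le_trans (sub_le_sub_left h 1) hx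

theorem EReal.exists_coe_eq_of_mem_Ioo {a b z : EReal} (h : z ∈ Set.Ioo a b) :
    ∃ x : ℝ, (x : EReal) = z :=
  ⟨z.toReal, EReal.coe_toReal (ne_top_of_lt h.2) (ne_bot_of_gt h.1)⟩

/-- Strictly below the Value-at-Risk the probability stays below the level. -/
theorem measureReal_lt_valueAtRisk_le [IsProbabilityMeasure μ] {b : ℝ}
    (hv : ⊥ < valueAtRisk μ X b) : μ.real {d | X d < valueAtRisk μ X b} ≤ 1 - b := by
  set v := valueAtRisk μ X b with hvdef
  -- Below the infimum every level fails strictly; continuity of the measure along `u k ↑ v` keeps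
  -- the non-strict bound.
  obtain ⟨u, hu_mono, hu_mem, hu_lim⟩ := exists_seq_strictMono_tendsto' hv
  have hu : ∀ k, μ.real {d | X d ≤ u k} < 1 - b := by
    intro k
    obtain ⟨x, hx⟩ := EReal.exists_coe_eq_of_mem_Ioo (hu_mem k)
    by_contra! hcon
    rw [← hx] at hcon
    have : v ≤ x := sInf_le ⟨x, hcon, rfl⟩
    exact this.not_gt (hx ▸ (hu_mem k).2)
  have hb : 0 ≤ 1 - b := measureReal_nonneg.trans (hu 0).le
  have hunion : {d | X d < v} = ⋃ k, {d | X d ≤ u k} := by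
    ext d
    simp only [Set.mem_ofPred_eq, Set.mem_iUnion]
    exact ⟨fun h => ((hu_lim.eventually_const_lt h).exists).imp fun k hk => hk.le,
      fun ⟨k, hk⟩ => hk.trans_lt (hu_mem k).2⟩
  have hmono : Monotone fun k => {d | X d ≤ u k} :=
    fun j k hjk d hd => le_trans (show X d ≤ u j from hd) (hu_mono.monotone hjk)
  refine ENNReal.toReal_le_of_le_ofReal hb ?_
  rw [hunion, Monotone.measure_iUnion hmono]
  exact iSup_le fun k => (ENNReal.le_ofReal_iff_toReal_le (measure_ne_top _ _) hb).2 (hu k).le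

/-- The Value-at-Risk satisfies its own probability constraint. -/
theorem le_measureReal_le_valueAtRisk [IsProbabilityMeasure μ] (hX : Measurable X) {b : ℝ}
    (hv : valueAtRisk μ X b < ⊤) : 1 - b ≤ μ.real {d | X d ≤ valueAtRisk μ X b} := by
  set v := valueAtRisk μ X b with hvdef
  -- Right continuity of the distribution function, along levels decreasing to `v`.
  obtain ⟨u, hu_anti, hu_mem, hu_lim⟩ := exists_seq_strictAnti_tendsto' hv
  have hu : ∀ k, 1 - b ≤ μ.real {d | X d ≤ u k} := by
    intro k
    obtain ⟨_, ⟨x, hx, rfl⟩, hxk⟩ := sInf_lt_iff.1 (show sInf _ < u k from (hu_mem k).1)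
    exact le_trans hx (measureReal_mono fun d hd => le_trans hd hxk.le)
  have hinter : {d | X d ≤ v} = ⋂ k, {d | X d ≤ u k} := by
    ext d
    simp only [Set.mem_ofPred_eq, Set.mem_iInter]
    exact ⟨fun h k => h.trans (hu_mem k).1.le, fun h => ge_of_tendsto' hu_lim h⟩
  have hanti : Antitone fun k => {d | X d ≤ u k} :=
    fun j k hjk d hd => le_trans (show X d ≤ u k from hd) (hu_anti.antitone hjk)
  refine (ENNReal.ofReal_le_iff_le_toReal (measure_ne_top _ _)).1 ?_
  rw [hinter, Antitone.measure_iInter hanti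
    (fun k => (measurableSet_le hX measurable_const).nullMeasurableSet)
    ⟨0, measure_ne_top _ _⟩]
  exact le_iInf fun k => (ENNReal.ofReal_le_iff_le_toReal (measure_ne_top _ _)).2 (hu k)

end ValueAtRisk

/-- The sampled problem attains its minimum when it is feasible. -/
theorem exists_isLeast_sampledFeasible {N : ℕ} {g : Fin N → EReal} (hg : ∀ i, g i ≠ ⊥) {β : ℝ}
    (hβ : β < 1) (hne : (sampledFeasible g β).Nonempty) :
    ∃ γ, IsLeast (sampledFeasible g β) γ := by
  -- The empirical probability jumps only at data points, so a feasible `γ` can be lowered to the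
  -- largest datum below it. One exists because `1 - β > 0`, and the minimum is then taken over
  -- finitely many data.
  have hdata : ∀ γ ∈ sampledFeasible g β, ∃ i, (g i).toReal ∈ sampledFeasible g β ∧
      (g i).toReal ≤ γ := by
    intro γ hγ
    have hγ' : 1 - β ≤ empiricalProb g γ := hγ
    have hI : (Finset.univ.filter fun i => g i ≤ γ).Nonempty := by
      by_contra hI
      rw [Finset.not_nonempty_iff_eq_empty, Finset.filter_eq_empty_iff] at hI
      have : empiricalProb g γ = 0 := by
        rw [empiricalProb, Finset.sum_eq_zero, mul_zero]
        intro i hi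
        exact Set.indicator_of_notMem (s := Set.Iic (γ : EReal)) (hI hi) _
      linarith
    obtain ⟨j, hj, hmax⟩ := Finset.exists_max_image _ g hI
    have hj : g j ≤ γ := (Finset.mem_filter.1 hj).2
    have hreal : ((g j).toReal : EReal) = g j :=
      EReal.coe_toReal (ne_top_of_le_ne_top (EReal.coe_ne_top γ) hj) (hg j)
    refine ⟨j, ?_, by rw [← hreal] at hj; exact_mod_cast hj⟩
    refine hγ'.trans (mul_le_mul_of_nonneg_left (Finset.sum_le_sum fun i _ => ?_) (by positivity))
    by_cases hi : g i ≤ γ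
    · have hij : g i ≤ ((g j).toReal : EReal) := by
        rw [hreal]
        exact hmax i (Finset.mem_filter.2 ⟨Finset.mem_univ i, hi⟩)
      rw [Set.indicator_of_mem (Set.mem_Iic.2 hi), Set.indicator_of_mem (Set.mem_Iic.2 hij)]
    · rw [Set.indicator_of_notMem (fun h => hi (Set.mem_Iic.1 h))]
      exact Set.indicator_nonneg (fun _ _ => zero_le_one) _
  classical
  obtain ⟨γ₀, hγ₀⟩ := hne
  obtain ⟨i₀, hi₀, -⟩ := hdata γ₀ hγ₀
  obtain ⟨j, hj, hmin⟩ := Finset.exists_min_image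
    (Finset.univ.filter fun i => (g i).toReal ∈ sampledFeasible g β) (fun i => (g i).toReal)
    ⟨i₀, Finset.mem_filter.2 ⟨Finset.mem_univ _, hi₀⟩⟩
  refine ⟨(g j).toReal, (Finset.mem_filter.1 hj).2, fun γ hγ => ?_⟩
  obtain ⟨i, hi, hiγ⟩ := hdata γ hγ
  exact (hmin i (Finset.mem_filter.2 ⟨Finset.mem_univ _, hi⟩)).trans hiγ

theorem sampledVaR_eq_of_isLeast {N : ℕ} {g : Fin N → EReal} {β γ : ℝ}
    (h : IsLeast (sampledFeasible g β) γ) : sampledVaR g β = (γ : EReal) :=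
  (EReal.coe_strictMono.monotone.map_isLeast h).csInf_eq

/-- Turns the random event into a deviation on the fixed set `{z < v}`; the strict inequality
matches `measureReal_lt_valueAtRisk_le`. -/
theorem le_empiricalFreq_of_sampledVaR_lt {N : ℕ} {g : Fin N → EReal} {β : ℝ} {v : EReal}
    (h : sampledVaR g β < v) : 1 - β ≤ empiricalFreq {z | z < v} g := by
  obtain ⟨_, ⟨γ, hγ, rfl⟩, hγv⟩ := sInf_lt_iff.1 h
  exact le_trans hγ (empiricalFreq_mono (fun z hz => lt_of_le_of_lt (Set.mem_Iic.1 hz) hγv) g)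

theorem empiricalFreq_lt_of_lt_sampledVaR {N : ℕ} {g : Fin N → EReal} {β : ℝ} {w : EReal}
    (h : w < sampledVaR g β) : empiricalFreq {z | z ≤ w} g < 1 - β := by
  by_contra! hcon
  refine h.not_ge (EReal.le_of_forall_lt_iff_le.1 fun x hx => sInf_le ⟨x, ?_, rfl⟩)
  exact hcon.trans
    (empiricalFreq_mono (D' := Set.Iic (x : EReal)) (fun z hz => le_trans hz hx.le) g)

/-- The sampled Value-at-Risk lies between the Values-at-Risk at the levels `β + ε` and `β - ε`
up to the two one-sided Hoeffding failure probabilities. -/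
theorem measureReal_sampledVaR_notMem_Icc_le {Ω S : Type*} [MeasurableSpace Ω] [MeasurableSpace S]
    {PΩ : Measure Ω} {Pr : Measure S} [IsProbabilityMeasure PΩ] [IsProbabilityMeasure Pr] {N : ℕ}
    {δ : Fin N → S → Ω} (hlaw : ∀ i, HasLaw (δ i) PΩ Pr) (hind : iIndepFun δ Pr)
    {X : Ω → EReal} (hX : Measurable X) {ε : ℝ} (hε : 0 ≤ ε) (β : ℝ) :
    Pr.real {ω | sampledVaR (fun i => X (δ i ω)) β ∉
      Set.Icc (valueAtRisk PΩ X (β + ε)) (valueAtRisk PΩ X (β - ε))} ≤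
      2 * Real.exp (-2 * N * ε ^ 2) := by
  set v := valueAtRisk PΩ X (β + ε) with hv
  set w := valueAtRisk PΩ X (β - ε) with hw
  rw [two_mul]
  refine le_trans ?_ (add_le_add
    (measureReal_empiricalFreq_sub_ge_le hlaw hind (measurableSet_lt hX (measurable_const (a := v)))
      hε)
    (measureReal_sub_empiricalFreq_ge_le hlaw hind (measurableSet_le hX (measurable_const (a := w)))
      hε))
  refine (measureReal_mono fun ω hω => ?_).trans (measureReal_union_le _ _)
  have hω : sampledVaR (fun i => X (δ i ω)) β ∉ Set.Icc v w := hω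
  rw [Set.mem_Icc, not_and_or, not_le, not_le] at hω
  -- Each alternative also rules out the infinite value (`v = ⊥`, respectively `w = ⊤`) for which
  -- the corresponding Value-at-Risk bound is unavailable.
  rcases hω with h | h
  · left
    have h1 : 1 - β ≤ empiricalFreq {d | X d < v} fun i => δ i ω :=
      le_empiricalFreq_of_sampledVaR_lt h
    have h2 := measureReal_lt_valueAtRisk_le (μ := PΩ) (X := X) (bot_le.trans_lt h)
    rw [← hv] at h2
    change ε ≤ _
    linarith
  · right
    have h1 : empiricalFreq {d | X d ≤ w} (fun i => δ i ω) < 1 - β :=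
      empiricalFreq_lt_of_lt_sampledVaR h
    have h2 := le_measureReal_le_valueAtRisk (μ := PΩ) hX (h.trans_le le_top)
    rw [← hw] at h2
    change ε ≤ _
    linarith

theorem theorem1
    {E : Type*} [NormedAddCommGroup E] [NormedSpace ℝ E] [MeasurableSpace E] [BorelSpace E]
    -- the uncertainty set and the law of the uncertainty
    (Ω : Set E) (_hΩ_closed : IsClosed Ω) (_hΩ_bdd : Bornology.IsBounded Ω) (_hΩ_zero : (0 : E) ∈ Ω)
    (PΩ : Measure Ω) [IsProbabilityMeasure PΩ]
    -- the uncertain control system, stable for every uncertainty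
    {nx nz ns nu nm np nr na : ℕ}
    (L : UncertainLoop Ω nx nz ns nu nm np nr na)
    (hL_meas : L.IsMeasurable)
    (hL_stable : ∀ δ : Ω, (L.closedLoop δ).IsStable)
    -- accuracy, confidence, risk level, number of samples
    (ε₁ β₁ β : ℝ) (hε₁ : ε₁ ∈ Set.Ioo (0 : ℝ) 1) (hβ₁ : β₁ ∈ Set.Ioo (0 : ℝ) 1)
    (hβ : β ∈ Set.Ioo (0 : ℝ) 1)
    (N₁ : ℕ) (hN₁ : 1 / (2 * ε₁ ^ 2) * Real.log (2 / β₁) ≤ (N₁ : ℝ))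
    -- the i.i.d. samples of the uncertainty
    {S : Type*} [MeasurableSpace S] (Pr : Measure S) [IsProbabilityMeasure Pr]
    (δ : Fin N₁ → S → Ω) (hδ_law : ∀ i, HasLaw (δ i) PΩ Pr) (hδ_indep : iIndepFun δ Pr) :
    -- the worst-case impact is a random variable, and the SDP computes it
    Measurable L.worstImpact ∧
    (∀ d : Ω, L.worstImpact d = (L.closedLoop d).sdpValue) ∧
    -- the empirical probability has accuracy `ε₁` with confidence `β₁`
    (∀ γ : ℝ,
      Pr.real {ω | ε₁ ≤ |PΩ.real {d | L.worstImpact d ≤ (γ : EReal)}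
        - empiricalProb (fun i => L.worstImpact (δ i ω)) γ|} ≤ β₁) ∧
    -- the sampled problem, with the SDP values as data, has a minimum as soon as it is feasible
    (∀ ω, (sampledFeasible (fun i => (L.closedLoop (δ i ω)).sdpValue) β).Nonempty →
      ∃ γ : ℝ, IsLeast (sampledFeasible (fun i => (L.closedLoop (δ i ω)).sdpValue) β) γ ∧
        sampledVaR (fun i => (L.closedLoop (δ i ω)).sdpValue) β = (γ : EReal)) ∧
    -- its value is the Value-at-Risk with accuracy `ε₁` in the probability level and
    -- confidence `β₁`
    valueAtRisk PΩ L.worstImpact β ∈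
      Set.Icc (valueAtRisk PΩ L.worstImpact (β + ε₁)) (valueAtRisk PΩ L.worstImpact (β - ε₁)) ∧
    Pr.real {ω | sampledVaR (fun i => (L.closedLoop (δ i ω)).sdpValue) β ∉
      Set.Icc (valueAtRisk PΩ L.worstImpact (β + ε₁)) (valueAtRisk PΩ L.worstImpact (β - ε₁))}
      ≤ β₁ := by
  have hmeas := UncertainLoop.measurable_worstImpact hL_meas hL_stable
  have hsdp : ∀ d : Ω, L.worstImpact d = (L.closedLoop d).sdpValue := fun d =>
    AttackedSystem.oog_eq_sdpValue (hL_stable d)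
  have hsize := two_mul_exp_le_of_sample_size hε₁.1 hβ₁.1 hN₁
  simp only [← hsdp]
  refine ⟨hmeas, fun _ => trivial, fun γ => ?_, fun ω hne => ?_, ⟨?_, ?_⟩, ?_⟩
  · exact (measureReal_abs_sub_empiricalFreq_ge_le hδ_law hδ_indep
      (measurableSet_le hmeas measurable_const) hε₁.1.le).trans hsize
  · obtain ⟨γ, hγ⟩ := exists_isLeast_sampledFeasible
      -- Impacts are nonnegative, so no datum is `⊥`.
      (fun i => ((bot_lt_iff_ne_bot.1
        (EReal.bot_lt_zero.trans_le (EReal.coe_ennreal_nonneg _)) : L.worstImpact (δ i ω) ≠ ⊥)))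
      hβ.2 hne
    exact ⟨γ, hγ, sampledVaR_eq_of_isLeast hγ⟩
  · exact valueAtRisk_antitone _ _ (by linarith [hε₁.1])
  · exact valueAtRisk_antitone _ _ (by linarith [hε₁.1])
  · exact (measureReal_sampledVaR_notMem_Icc_le hδ_law hδ_indep hmeas hε₁.1.le β).trans hsize
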